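/- Let $q$ be a prime, let $\log$ be the logarithm to base $2$ and $H$ the Shannon entropy in bits. Let $D(q):=H(U_1+U_2)-\log q$, where $U_1,U_2$ are independent and uniform on $\{0,\dots,q-1\}\subset\mathbb Z$ and $U_1+U_2$ is their integer sum. Write $a_n\doteq 2^{nb}$ if there are $\epsilon_n\searrow 0$ with $2^{n(b-\epsilon_n)}\le a_n\le 2^{n(b+\epsilon_n)}$ for all large $n$. For every $n$ let $C_1^{(n)},C_2^{(n)}\subseteq\mathbb F_q^n$ be linear codes (subspaces), such that the rates $R_j:=\lim_{n\to\infty}\frac1n\log|C_j^{(n)}|$, $j=1,2$, exist, and let $d^{(n)}\in\mathbb F_q^n$ be a fixed vector (for instance $d^{(n)}=0$). View the coset $C_1^{(n)}\oplus d^{(n)}$ (addition modulo $q$) and the code $C_2^{(n)}$ as sets of integer vectors with entries in $\{0,\dots,q-1\}$. Let $T_1^n$ and $T_2^n$ be independent random vectors, uniformly distributed on $C_1^{(n)}\oplus d^{(n)}$ and on $C_2^{(n)}$ respectively, and let $T_1^n+T_2^n$ be their sum in $\mathbb Z^n$. Suppose that these codes have a normal typical sumset, that is, there are sets $\mathcal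 K^{(n)}\subseteq (C_1^{(n)}\oplus d^{(n)})+C_2^{(n)}$ (sumset in $\mathbb Z^n$) such that $\Pr[T_1^n+T_2^n\in\mathcal K^{(n)}]\to1$, $$|\mathcal K^{(n)}|\doteq\min\{2^{n(R_1+R_2)},\,2^{n(\max\{R_1,R_2\}+D(q))}\},$$ and, uniformly for all $w\in\mathcal K^{(n)}$, $$\Pr[T_1^n+T_2^n=w]\doteq\max\{2^{-n(R_1+R_2)},\,2^{-n(\max\{R_1,R_2\}+D(q))}\}.$$ Then $$\lim_{n\to\infty}\frac{H(T_1^n+T_2^n)}{n}=\min\{R_1+R_2,\ \max\{R_1,R_2\}+D(q)\},$$ and the same number is the limit $$\lim_{n\to\infty}\min\Big\{\frac{H(T_1^n)+H(T_2^n)}{n},\ \frac{\max\{H(T_1^n),H(T_2^n)\}}{n}+D(q)\Big\}.$$ -/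

import Mathlib

open MeasureTheory ProbabilityTheory Filter Topology
open scoped Pointwise

/-- A word over `𝔽_q = ZMod q`, read as an integer vector with entries in `{0, …, q - 1}`. -/
def intVec {q n : ℕ} (t : Fin n → ZMod q) : Fin n → ℤ :=
  fun i => ((t i).val : ℤ)

/-- The coset `C ⊕ d` (addition modulo `q`) of a linear code `C ⊆ 𝔽_q ^ n`, viewed as a set of
integer vectors with entries in `{0, …, q - 1}`. For `d = 0` this is the code itself. -/
def codebook {q n : ℕ} (C : Submodule (ZMod q) (Fin n → ZMod q)) (d : Fin n → ZMod q) :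
    Set (Fin n → ℤ) :=
  (fun t => intVec (t + d)) '' (C : Set (Fin n → ZMod q))

/-- The Shannon entropy, in bits, of a probability measure on a discrete space:
`- ∑ x, μ(x) log₂ μ(x)`, with `0 log 0 = 0`. It is only used for finitely supported measures. -/
noncomputable def entropyBits {S : Type*} [MeasurableSpace S] (μ : Measure S) : ℝ :=
  ∑' x, -(μ.real {x} * Real.logb 2 (μ.real {x}))

/-- The Shannon entropy `H(X)`, in bits, of a discrete random variable `X`. -/
noncomputable def rvEntropy {Ω S : Type*} [MeasurableSpace Ω] [MeasurableSpace S]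
    (P : Measure Ω) (X : Ω → S) : ℝ :=
  entropyBits (P.map X)

/-- The law of `T₁ + T₂` (addition in the ambient monoid) for independent `T₁`, `T₂` which are
uniformly distributed on `A` and on `B`. -/
noncomputable def sumLaw {M : Type*} [AddMonoid M] [MeasurableSpace M] (A B : Set M) : Measure M :=
  ((uniformOn A).prod (uniformOn B)).map (fun p => p.1 + p.2)

/-- `D(q) = H(U₁ + U₂) - log₂ q` with `U₁`, `U₂` independent and uniform on `{0, …, q - 1}`, the
sum being taken in `ℤ`. -/
noncomputable def sumsetD (q : ℕ) : ℝ :=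
  entropyBits (sumLaw (Set.Ico (0 : ℤ) q) (Set.Ico (0 : ℤ) q)) - Real.logb 2 q

/-- `a n w ≐ 2 ^ (n b)`, uniformly over `w ∈ s n`: there is `ε n ↘ 0` such that, for large `n`,
`2 ^ (n (b - ε n)) ≤ a n w ≤ 2 ^ (n (b + ε n))` for all `w ∈ s n`. -/
def DotEqOn {ι : ℕ → Type*} (s : ∀ n, Set (ι n)) (a : ∀ n, ι n → ℝ) (b : ℝ) : Prop :=
  ∃ ε : ℕ → ℝ, Antitone ε ∧ Tendsto ε atTop (𝓝 0) ∧
    ∀ᶠ n : ℕ in atTop, ∀ w ∈ s n,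
      (2 : ℝ) ^ ((n : ℝ) * (b - ε n)) ≤ a n w ∧ a n w ≤ (2 : ℝ) ^ ((n : ℝ) * (b + ε n))

/-- `a n ≐ 2 ^ (n b)`: there is `ε n ↘ 0` such that, for large `n`,
`2 ^ (n (b - ε n)) ≤ a n ≤ 2 ^ (n (b + ε n))`. -/
def DotEq (a : ℕ → ℝ) (b : ℝ) : Prop :=
  ∃ ε : ℕ → ℝ, Antitone ε ∧ Tendsto ε atTop (𝓝 0) ∧
    ∀ᶠ n : ℕ in atTop,
      (2 : ℝ) ^ ((n : ℝ) * (b - ε n)) ≤ a n ∧ a n ≤ (2 : ℝ) ^ ((n : ℝ) * (b + ε n))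

/-- `K n ⊆ A n + B n` is a sequence of typical sumsets of `A n`, `B n`: the sum of two independent
uniformly distributed elements of `A n` and `B n` is in `K n` asymptotically almost surely. -/
structure IsTypicalSumset (A B K : ∀ n : ℕ, Set (Fin n → ℤ)) : Prop where
  subset_add : ∀ n, K n ⊆ A n + B n
  tendsto_prob : Tendsto (fun n => (sumLaw (A n) (B n)).real (K n)) atTop (𝓝 1)

/-- `K n` is a sequence of normal typical sumsets of the codebooks `A n`, `B n` over `𝔽_q` with
asymptotic rates `R₁`, `R₂`: typical sumsets with
`|K n| ≐ min {2 ^ (n (R₁ + R₂)), 2 ^ (n (max {R₁, R₂} + D(q)))}` such that the law of the sum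
satisfies `P(w) ≐ max {2 ^ (- n (R₁ + R₂)), 2 ^ (- n (max {R₁, R₂} + D(q)))}` for all `w ∈ K n`. -/
structure IsNormalTypicalSumset (q : ℕ) (R₁ R₂ : ℝ) (A B K : ∀ n : ℕ, Set (Fin n → ℤ)) : Prop
    extends IsTypicalSumset A B K where
  card_doteq : DotEq (fun n => ((K n).ncard : ℝ)) (min (R₁ + R₂) (max R₁ R₂ + sumsetD q))
  prob_doteq : DotEqOn K (fun n w => (sumLaw (A n) (B n)).real {w})
    (-min (R₁ + R₂) (max R₁ R₂ + sumsetD q))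

/-! Let `I` be the claimed limit. On `K n` every point has self-information `n (I ± ε n)`, and `K n`
carries mass `p n → 1`, so it contributes between `p n * n (I - ε n)` and `p n * n (I + ε n)` to the
entropy. The atypical mass `1 - p n` lives on at most `q ^ (2 n)` points and contributes at most `(1
- p n) * 2 n log₂ q + O(1) = o(n)`. Dividing by `n` and squeezing gives the first limit;
`entropyBits_bounds` is the quantitative form. For the second limit, each `T_j` is uniform on a set
of `|C_j|` points, so its entropy is exactly `log₂ |C_j|`; continuity of `min` and `max` finishes.
-/

section Entropy

variable {S : Type*} [MeasurableSpace S]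

lemma entropyBits_eq_sum {μ : Measure S} {s : Finset S} (hs : μ (s : Set S)ᶜ = 0) :
    entropyBits μ = ∑ x ∈ s, -(μ.real {x} * Real.logb 2 (μ.real {x})) := by
  refine tsum_eq_sum fun x hx => ?_
  have : μ {x} = 0 := measure_mono_null (by simpa using hx) hs
  simp [measureReal_def, this]

variable [MeasurableSingletonClass S]

lemma entropyBits_uniformOn {A : Set S} (hA : A.Finite) (hA' : A.Nonempty) :
    entropyBits (uniformOn A) = Real.logb 2 A.ncard := by
  have hA1 : uniformOn A A = 1 := uniformOn_self hA hA'
  have := isProbabilityMeasure_uniformOn hA hA'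
  have hc : uniformOn A (hA.toFinset : Set S)ᶜ = 0 := by
    rw [hA.coe_toFinset, prob_compl_eq_zero_iff hA.measurableSet, hA1]
  have hcard : (A.ncard : ℝ) ≠ 0 := by
    exact_mod_cast (Set.ncard_ne_zero_of_mem hA'.some_mem hA)
  have hp : ∀ x ∈ hA.toFinset, (uniformOn A).real {x} = (A.ncard : ℝ)⁻¹ := by
    intro x hx
    have hx' : x ∈ A := by simpa using hx
    rw [measureReal_def, uniformOn, ProbabilityTheory.cond_apply hA.measurableSet,
      Set.inter_eq_self_of_subset_right (by simpa using hx'), Measure.count_singleton,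
      Measure.count_apply_finite A hA, Set.ncard_eq_toFinset_card A hA]
    simp
  rw [entropyBits_eq_sum hc, Finset.sum_congr rfl fun x hx => by rw [hp x hx],
    Finset.sum_const, ← Set.ncard_eq_toFinset_card A hA, Real.logb_inv, nsmul_eq_mul]
  field_simp

lemma neg_mul_logb_nonneg {p : ℝ} (h0 : 0 ≤ p) (h1 : p ≤ 1) : 0 ≤ -(p * Real.logb 2 p) := by
  have := mul_nonpos_of_nonneg_of_nonpos h0 (Real.logb_nonpos one_lt_two h0 h1)
  linarith

/-- This is `log x ≤ x - 1` at `x = (p N)⁻¹`. Summed over at most `N` atoms of total mass `m`, it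
gives `m log₂ N + 1 / log 2`, so the atypical part needs neither normalisation nor Jensen. -/
lemma neg_mul_logb_le {p N : ℝ} (hp : 0 ≤ p) (hN : 0 < N) :
    -(p * Real.logb 2 p) ≤ p * Real.logb 2 N + N⁻¹ * (Real.log 2)⁻¹ := by
  have h2 : 0 < Real.log 2 := Real.log_pos one_lt_two
  rcases hp.eq_or_lt with rfl | hp
  · simp only [zero_mul, neg_zero, zero_add]; positivity
  have h := Real.log_le_sub_one_of_pos (x := (p * N)⁻¹) (by positivity)
  rw [Real.log_inv, Real.log_mul hp.ne' hN.ne'] at h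
  have h' := mul_le_mul_of_nonneg_left h hp.le
  have e : p * ((p * N)⁻¹ - 1) = N⁻¹ - p := by field_simp
  rw [e] at h'
  have h3 : -(p * Real.log p) - p * Real.log N ≤ N⁻¹ := by linarith
  have h4 := mul_le_mul_of_nonneg_right h3 (inv_nonneg.2 h2.le)
  simp only [Real.logb, div_eq_mul_inv]
  linarith

/-- Entropy bounds for a law supported on a set of at most `N` points, most of whose mass lies in
a set `t` on which the self-information is between `a` and `b`. -/
lemma entropyBits_bounds {μ : Measure S} [IsProbabilityMeasure μ] {s t : Set S} (hs : s.Finite)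
    (hμ : μ sᶜ = 0) (hts : t ⊆ s) {N : ℝ} (hN : 0 < N) (hsN : (s.ncard : ℝ) ≤ N) {a b : ℝ}
    (hab : ∀ x ∈ t, a ≤ -Real.logb 2 (μ.real {x}) ∧ -Real.logb 2 (μ.real {x}) ≤ b) :
    μ.real t * a ≤ entropyBits μ ∧
      entropyBits μ ≤ μ.real t * b + (1 - μ.real t) * Real.logb 2 N + (Real.log 2)⁻¹ := by
  classical
  have h2 : 0 < Real.log 2 := Real.log_pos one_lt_two
  lift s to Finset S using hs
  lift t to Finset S using s.finite_toSet.subset hts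
  have hts : t ⊆ s := by exact_mod_cast hts
  rw [Set.ncard_coe_finset] at hsN
  have hsum (u : Finset S) : ∑ x ∈ u, μ.real {x} = μ.real (u : Set S) :=
    sum_measureReal_singleton u
  have hs1 : μ.real (s : Set S) = 1 := by
    rw [measureReal_def, (prob_compl_eq_zero_iff s.measurableSet).1 hμ, ENNReal.toReal_one]
  have hrest : ∑ x ∈ s \ t, μ.real {x} = 1 - μ.real (t : Set S) := by
    have := Finset.sum_sdiff (f := fun x => μ.real {x}) hts
    rw [hsum s, hsum t, hs1] at this
    linarith
  rw [entropyBits_eq_sum hμ, ← Finset.sum_sdiff hts, ← hrest, ← hsum t]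
  constructor
  · have h1 : 0 ≤ ∑ x ∈ s \ t, -(μ.real {x} * Real.logb 2 (μ.real {x})) :=
      Finset.sum_nonneg fun x _ => neg_mul_logb_nonneg measureReal_nonneg measureReal_le_one
    have h3 : (∑ x ∈ t, μ.real {x}) * a ≤ ∑ x ∈ t, -(μ.real {x} * Real.logb 2 (μ.real {x})) := by
      rw [Finset.sum_mul]
      refine Finset.sum_le_sum fun x hx => ?_
      rw [← mul_neg]
      exact mul_le_mul_of_nonneg_left (hab x hx).1 measureReal_nonneg
    linarith
  · have h3 : ∑ x ∈ t, -(μ.real {x} * Real.logb 2 (μ.real {x})) ≤ (∑ x ∈ t, μ.real {x}) * b := by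
      rw [Finset.sum_mul]
      refine Finset.sum_le_sum fun x hx => ?_
      rw [← mul_neg]
      exact mul_le_mul_of_nonneg_left (hab x hx).2 measureReal_nonneg
    have h1 : ∑ x ∈ s \ t, -(μ.real {x} * Real.logb 2 (μ.real {x})) ≤
        (∑ x ∈ s \ t, μ.real {x}) * Real.logb 2 N + (Real.log 2)⁻¹ := by
      calc _ ≤ ∑ x ∈ s \ t, (μ.real {x} * Real.logb 2 N + N⁻¹ * (Real.log 2)⁻¹) :=
            Finset.sum_le_sum fun x _ => neg_mul_logb_le measureReal_nonneg hN
        _ = (∑ x ∈ s \ t, μ.real {x}) * Real.logb 2 N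
            + ((s \ t).card : ℝ) * N⁻¹ * (Real.log 2)⁻¹ := by
          rw [Finset.sum_add_distrib, ← Finset.sum_mul, Finset.sum_const, nsmul_eq_mul, mul_assoc]
        -- At most `N` error terms of size `N⁻¹ / log 2` add up to a constant independent of `N`.
        _ ≤ _ := by
          have hc : ((s \ t).card : ℝ) ≤ N :=
            le_trans (by exact_mod_cast Finset.card_le_card Finset.sdiff_subset) hsN
          have : ((s \ t).card : ℝ) * N⁻¹ ≤ 1 := by
            rw [← div_eq_mul_inv]; exact (div_le_one hN).2 hc
          have := mul_le_mul_of_nonneg_right this (inv_nonneg.2 h2.le)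
          linarith
    linarith

end Entropy

section SumLaw

variable {M : Type*} [AddMonoid M] [Countable M] [MeasurableSpace M] [MeasurableSingletonClass M]

lemma isProbabilityMeasure_sumLaw {A B : Set M} (hA : A.Finite) (hA' : A.Nonempty)
    (hB : B.Finite) (hB' : B.Nonempty) : IsProbabilityMeasure (sumLaw A B) := by
  have := isProbabilityMeasure_uniformOn hA hA'
  have := isProbabilityMeasure_uniformOn hB hB'
  exact Measure.isProbabilityMeasure_map (Measurable.of_discrete).aemeasurable

lemma sumLaw_compl_add {A B : Set M} (hA : A.Finite) (hA' : A.Nonempty)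
    (hB : B.Finite) (hB' : B.Nonempty) : sumLaw A B (A + B)ᶜ = 0 := by
  have := isProbabilityMeasure_uniformOn hA hA'
  have := isProbabilityMeasure_uniformOn hB hB'
  have := isProbabilityMeasure_sumLaw hA hA' hB hB'
  rw [prob_compl_eq_zero_iff (hA.add hB).measurableSet]
  refine le_antisymm prob_le_one ?_
  rw [sumLaw, Measure.map_apply Measurable.of_discrete (hA.add hB).measurableSet]
  calc (1 : ENNReal) = ((uniformOn A).prod (uniformOn B)) (A ×ˢ B) := by
        rw [Measure.prod_prod, uniformOn_self hA hA', uniformOn_self hB hB', one_mul]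
    _ ≤ _ := measure_mono fun p hp => Set.add_mem_add hp.1 hp.2

lemma map_add_eq_sumLaw {Ω : Type*} [MeasurableSpace Ω] {P : Measure Ω} [IsProbabilityMeasure P]
    {X Y : Ω → M} {A B : Set M} (hX : HasLaw X (uniformOn A) P) (hY : HasLaw Y (uniformOn B) P)
    (h : IndepFun X Y P) : P.map (fun ω => X ω + Y ω) = sumLaw A B := by
  rw [sumLaw, ← hX.map_eq, ← hY.map_eq,
    ← (indepFun_iff_map_prod_eq_prod_map_map hX.aemeasurable hY.aemeasurable).1 h,
    AEMeasurable.map_map_of_aemeasurable (Measurable.of_discrete).aemeasurable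
      (hX.aemeasurable.prodMk hY.aemeasurable)]
  rfl

end SumLaw

section Codebook

variable {q n : ℕ} (C : Submodule (ZMod q) (Fin n → ZMod q)) (d : Fin n → ZMod q)

lemma codebook_nonempty : (codebook C d).Nonempty := ⟨_, 0, C.zero_mem, rfl⟩

variable [NeZero q]

lemma intVec_injective : Function.Injective (intVec : (Fin n → ZMod q) → Fin n → ℤ) := by
  intro a b h
  funext i
  have := congrFun h i
  exact ZMod.val_injective q (Nat.cast_injective (R := ℤ) this)

lemma codebook_finite : (codebook C d).Finite := (Set.toFinite _).image _

/-- Translation by `d` and passage to integer representatives are both injective. -/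
lemma ncard_codebook : (codebook C d).ncard = Nat.card C :=
  Set.ncard_image_of_injective _ (intVec_injective.comp (add_left_injective d))

lemma ncard_codebook_le : (codebook C d).ncard ≤ q ^ n := by
  rw [ncard_codebook]
  calc Nat.card C ≤ Nat.card (Fin n → ZMod q) :=
        Nat.card_le_card_of_injective _ Subtype.val_injective
    _ = q ^ n := by simp

end Codebook

theorem theorem3 (q : ℕ) [Fact q.Prime]
    (C₁ C₂ : ∀ n : ℕ, Submodule (ZMod q) (Fin n → ZMod q))
    (d : ∀ n : ℕ, Fin n → ZMod q)
    (R₁ R₂ : ℝ)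
    (hR₁ : Tendsto (fun n : ℕ => Real.logb 2 (Nat.card (C₁ n)) / n) atTop (𝓝 R₁))
    (hR₂ : Tendsto (fun n : ℕ => Real.logb 2 (Nat.card (C₂ n)) / n) atTop (𝓝 R₂))
    (K : ∀ n : ℕ, Set (Fin n → ℤ))
    (hK : IsNormalTypicalSumset q R₁ R₂
      (fun n => codebook (C₁ n) (d n)) (fun n => codebook (C₂ n) 0) K)
    {Ω : ℕ → Type*} [∀ n, MeasurableSpace (Ω n)]
    (P : ∀ n, Measure (Ω n)) [∀ n, IsProbabilityMeasure (P n)]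
    (T₁ T₂ : ∀ n, Ω n → (Fin n → ℤ))
    (hT₁ : ∀ n, HasLaw (T₁ n) (uniformOn (codebook (C₁ n) (d n))) (P n))
    (hT₂ : ∀ n, HasLaw (T₂ n) (uniformOn (codebook (C₂ n) 0)) (P n))
    (hindep : ∀ n, IndepFun (T₁ n) (T₂ n) (P n)) :
    Tendsto (fun n : ℕ => rvEntropy (P n) (fun ω => T₁ n ω + T₂ n ω) / n) atTop
        (𝓝 (min (R₁ + R₂) (max R₁ R₂ + sumsetD q))) ∧
      Tendsto (fun n : ℕ =>
          min ((rvEntropy (P n) (T₁ n) + rvEntropy (P n) (T₂ n)) / n)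
            (max (rvEntropy (P n) (T₁ n)) (rvEntropy (P n) (T₂ n)) / n + sumsetD q)) atTop
        (𝓝 (min (R₁ + R₂) (max R₁ R₂ + sumsetD q))) := by
  have hq : (0 : ℝ) < q := by exact_mod_cast (Fact.out : q.Prime).pos
  have hH₁ (n) : rvEntropy (P n) (T₁ n) = Real.logb 2 (Nat.card (C₁ n)) := by
    rw [rvEntropy, (hT₁ n).map_eq,
      entropyBits_uniformOn (codebook_finite _ _) (codebook_nonempty _ _), ncard_codebook]
  have hH₂ (n) : rvEntropy (P n) (T₂ n) = Real.logb 2 (Nat.card (C₂ n)) := by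
    rw [rvEntropy, (hT₂ n).map_eq,
      entropyBits_uniformOn (codebook_finite _ _) (codebook_nonempty _ _), ncard_codebook]
  refine ⟨?_, ?_⟩
  · obtain ⟨ε, -, hε, hK'⟩ := hK.prob_doteq
    have hp := hK.tendsto_prob
    set I := min (R₁ + R₂) (max R₁ R₂ + sumsetD q)
    set p : ℕ → ℝ := fun n => (sumLaw (codebook (C₁ n) (d n)) (codebook (C₂ n) 0)).real (K n)
    have hbounds : ∀ᶠ n : ℕ in atTop,
        p n * (I - ε n) ≤ rvEntropy (P n) (fun ω => T₁ n ω + T₂ n ω) / n ∧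
          rvEntropy (P n) (fun ω => T₁ n ω + T₂ n ω) / n ≤
            p n * (I + ε n) + (1 - p n) * (2 * Real.logb 2 q) + (Real.log 2)⁻¹ / n := by
      filter_upwards [hK', eventually_gt_atTop 0] with n hn hn0
      have hn0 : (0 : ℝ) < n := by exact_mod_cast hn0
      have hA := codebook_finite (C₁ n) (d n)
      have hA' := codebook_nonempty (C₁ n) (d n)
      have hB := codebook_finite (C₂ n) 0
      have hB' := codebook_nonempty (C₂ n) 0
      have := isProbabilityMeasure_sumLaw hA hA' hB hB'
      have hcard : ((codebook (C₁ n) (d n) + codebook (C₂ n) 0).ncard : ℝ) ≤ (q : ℝ) ^ (2 * n) := by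
        have h : (codebook (C₁ n) (d n) + codebook (C₂ n) 0).ncard ≤ q ^ n * q ^ n :=
          (Set.natCard_add_le).trans
            (Nat.mul_le_mul (ncard_codebook_le _ _) (ncard_codebook_le _ _))
        rw [two_mul, pow_add]
        exact_mod_cast h
      obtain ⟨h1, h2⟩ := entropyBits_bounds (hA.add hB) (sumLaw_compl_add hA hA' hB hB')
        (hK.subset_add n) (pow_pos hq (2 * n)) hcard (a := n * (I - ε n)) (b := n * (I + ε n))
        (fun w hw => by
          obtain ⟨hl, hu⟩ := hn w hw
          -- The lower bound makes the probability positive, which excludes the junk value `logb 2 0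
          -- = 0`.
          have hpos := (Real.rpow_pos_of_pos two_pos _).trans_le hl
          have hl' := Real.logb_le_logb_of_le one_lt_two (Real.rpow_pos_of_pos two_pos _) hl
          have hu' := Real.logb_le_logb_of_le one_lt_two hpos hu
          rw [Real.logb_rpow two_pos one_lt_two.ne'] at hl' hu'
          constructor <;> linarith)
      rw [rvEntropy, map_add_eq_sumLaw (hT₁ n) (hT₂ n) (hindep n), le_div_iff₀ hn0,
        div_le_iff₀ hn0]
      rw [Real.logb_pow] at h2
      push_cast at h2
      refine ⟨le_trans (le_of_eq ?_) h1, h2.trans (le_of_eq ?_)⟩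
      · ring
      · rw [add_mul, add_mul, div_mul_cancel₀ _ hn0.ne']
        ring
    have hlow : Tendsto (fun n => p n * (I - ε n)) atTop (𝓝 I) := by
      simpa using hp.mul (tendsto_const_nhds.sub hε)
    have hup : Tendsto (fun n : ℕ => p n * (I + ε n) + (1 - p n) * (2 * Real.logb 2 q)
        + (Real.log 2)⁻¹ / n) atTop (𝓝 I) := by
      simpa using ((hp.mul (tendsto_const_nhds.add hε)).add
        (((tendsto_const_nhds (x := (1 : ℝ))).sub hp).mul_const (2 * Real.logb 2 q))).add
          (tendsto_const_div_atTop_nhds_zero_nat (Real.log 2)⁻¹)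
    exact tendsto_of_tendsto_of_tendsto_of_le_of_le' hlow hup
      (hbounds.mono fun _ h => h.1) (hbounds.mono fun _ h => h.2)
  · refine ((hR₁.add hR₂).min ((hR₁.max hR₂).add_const _)).congr fun n => ?_
    rw [hH₁, hH₂, add_div, max_div_div_right n.cast_nonneg]
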